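/- For $\alpha\in[0,1]$, put $\beta=\sqrt{1-\alpha^2}$. For $c_0>0$, let $\{\vec m_{c_0,\alpha},\vec n_{c_0,\alpha},\vec b_{c_0,\alpha}\}$ be the unique solution on $\mathbb R$ of the Serret--Frenet system $$\vec m'=c\,\vec n,\qquad \vec n'=-c\,\vec m+\tau\,\vec b,\qquad \vec b'=-\tau\,\vec n,$$ with curvature $c(s)=c_0e^{-\alpha s^2/4}$, torsion $\tau(s)=\beta s/2$ and initial conditions $\vec m(0)=(1,0,0)$, $\vec n(0)=(0,1,0)$, $\vec b(0)=(0,0,1)$. Let $\vec m_{c_0,\alpha}(s,t)=\vec m_{c_0,\alpha}(s/\sqrt t)$ for $t>0$ be the associated self-similar function, and let $\vec A^{+}_{c_0,\alpha}$ and $\vec A^{-}_{c_0,\alpha}$ denote its pointwise limits as $t\to0^+$: $$\lim_{t\to0^+}\vec m_{c_0,\alpha}(s,t)=\vec A^{+}_{c_0,\alpha}\ \text{ for all } s>0,\qquad \lim_{t\to0^+}\vec m_{c_0,\alpha}(s,t)=\vec A^{-}_{c_0,\alpha}\ \text{ for all } s<0.$$ **Proposition 1.5.** The following statements hold, where in each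 case the limits $\vec A^{\pm}_{c_0,\alpha}$ exist. (i) For every $\alpha\in(0,1)$ there exists $c_0^*>0$, depending on $\alpha$, such that $\vec A^{+}_{c_0,\alpha}\neq\vec A^{-}_{c_0,\alpha}$ for all $c_0\in(0,c_0^*)$. (ii) For every $c_0>0$ there exists $\alpha_0^*\in(0,1)$, depending on $c_0$, such that $\vec A^{+}_{c_0,\alpha}\neq\vec A^{-}_{c_0,\alpha}$ for all $\alpha\in(0,\alpha_0^*)$. (iii) For every $c_0>0$ with $c_0\neq k\sqrt\pi$ for all $k\in\mathbb N$, there exists $\alpha_1^*\in(0,1)$, depending on $c_0$, such that $\vec A^{+}_{c_0,\alpha}\neq\vec A^{-}_{c_0,\alpha}$ for all $\alpha\in(\alpha_1^*,1)$. -/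

import Mathlib

open Set Filter Topology

/-- Three-dimensional Euclidean space. -/
abbrev E3 : Type := EuclideanSpace ℝ (Fin 3)

/-- `(m, n, b)` is a global solution of the Serret--Frenet system `m' = κ n`, `n' = -κ m + τ b`,
`b' = -τ n` with curvature `κ` and torsion `τ`, starting at `s = 0` from the canonical basis. -/
structure IsFrenetFrame (κ τ : ℝ → ℝ) (m n b : ℝ → E3) : Prop where
  deriv_m : ∀ s, HasDerivAt m (κ s • n s) s
  deriv_n : ∀ s, HasDerivAt n (-(κ s) • m s + τ s • b s) s
  deriv_b : ∀ s, HasDerivAt b (-(τ s) • n s) s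
  m_zero : m 0 = !₂[(1 : ℝ), 0, 0]
  n_zero : n 0 = !₂[(0 : ℝ), 1, 0]
  b_zero : b 0 = !₂[(0 : ℝ), 0, 1]

section Existence

variable {V : Type*} [NormedAddCommGroup V] [InnerProductSpace ℝ V]

/-- A curve that stays orthogonal to its velocity has constant norm. -/
theorem norm_eq_of_inner_deriv_eq_zero {y v : ℝ → V} {N : ℝ}
    (hy : ∀ t ∈ Icc (-N) N, HasDerivWithinAt y (v t) (Icc (-N) N) t)
    (hv : ∀ t ∈ Icc (-N) N, inner ℝ (y t) (v t) = 0) {t : ℝ} (ht : t ∈ Icc (-N) N) :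
    ‖y t‖ = ‖y 0‖ := by
  have hd : ∀ t ∈ Icc (-N) N, HasDerivWithinAt (fun t => ‖y t‖ ^ 2) 0 (Icc (-N) N) t := by
    intro t ht
    have h := (hy t ht).norm_sq
    rwa [hv t ht, mul_zero] at h
  have hc : ∀ x ∈ Icc (-N) N, ‖y x‖ ^ 2 = ‖y (-N)‖ ^ 2 := by
    refine constant_of_has_deriv_right_zero (fun x hx => (hd x hx).continuousWithinAt) ?_
    intro x hx
    exact (hd x (Ico_subset_Icc_self hx)).mono_of_mem_nhdsWithin
      (Icc_mem_nhdsGE_of_mem hx)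
  have h0 : (0 : ℝ) ∈ Icc (-N) N := by
    have := ht.1; have := ht.2
    constructor <;> linarith
  have h := (hc t ht).trans (hc 0 h0).symm
  exact (pow_left_inj₀ (norm_nonneg _) (norm_nonneg _) two_ne_zero).1 h

/-- The radial truncation `y ↦ y / max 1 ‖y‖` is Lipschitz. -/
theorem radial_lipschitz (y z : V) :
    ‖(max 1 ‖y‖)⁻¹ • y - (max 1 ‖z‖)⁻¹ • z‖ ≤ 2 * ‖y - z‖ := by
  set M := max 1 ‖y‖ with hM
  set N := max 1 ‖z‖ with hN
  have hM1 : 1 ≤ M := le_max_left _ _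
  have hN1 : 1 ≤ N := le_max_left _ _
  have hzN : ‖z‖ ≤ N := le_max_right _ _
  have hMN : |N - M| ≤ ‖y - z‖ := by
    have h1 : |N - M| ≤ |‖z‖ - ‖y‖| := by
      simpa [hM, hN] using abs_max_sub_max_le_abs ‖z‖ ‖y‖ (1 : ℝ) |>.trans' (by
        rw [max_comm 1 ‖z‖, max_comm 1 ‖y‖])
    calc |N - M| ≤ |‖z‖ - ‖y‖| := h1
      _ ≤ ‖z - y‖ := abs_norm_sub_norm_le z y
      _ = ‖y - z‖ := norm_sub_rev z y
  have e : M⁻¹ • y - N⁻¹ • z = M⁻¹ • (y - z) + (M⁻¹ - N⁻¹) • z := by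
    rw [smul_sub, sub_smul]; abel
  have hMi : M⁻¹ ≤ 1 := inv_le_one_of_one_le₀ hM1
  have hMi0 : 0 ≤ M⁻¹ := by positivity
  have hb : ‖(M⁻¹ - N⁻¹) • z‖ ≤ ‖y - z‖ := by
    have e2 : M⁻¹ - N⁻¹ = M⁻¹ * N⁻¹ * (N - M) := by
      field_simp
    rw [norm_smul, e2, Real.norm_eq_abs, abs_mul, abs_of_nonneg (by positivity : 0 ≤ M⁻¹ * N⁻¹)]
    have h3 : N⁻¹ * ‖z‖ ≤ 1 := by
      rw [inv_mul_le_iff₀ (by positivity)]; linarith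
    calc M⁻¹ * N⁻¹ * |N - M| * ‖z‖ = M⁻¹ * (N⁻¹ * ‖z‖) * |N - M| := by ring
      _ ≤ 1 * 1 * |N - M| := by gcongr
      _ ≤ ‖y - z‖ := by linarith
  have ha : ‖M⁻¹ • (y - z)‖ ≤ ‖y - z‖ := by
    rw [norm_smul, Real.norm_eq_abs, abs_of_nonneg hMi0]
    exact mul_le_of_le_one_left (norm_nonneg _) hMi
  rw [e]
  exact (norm_add_le _ _).trans (by linarith)

/-- Existence on a compact interval for a skew linear system, started from a unit vector. -/
theorem exists_skew_solution_Icc [CompleteSpace V] (P Q : V →L[ℝ] V) (hP : ∀ y, inner ℝ y (P y) = 0)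
    (hQ : ∀ y, inner ℝ y (Q y) = 0) {κ τ : ℝ → ℝ} (hκ : Continuous κ) (hτ : Continuous τ)
    (x₀ : V) (hx₀ : ‖x₀‖ = 1) {N : ℝ} (hN : 0 ≤ N) :
    ∃ y : ℝ → V, y 0 = x₀ ∧ ∀ t ∈ Icc (-N) N,
      HasDerivWithinAt y (κ t • P (y t) + τ t • Q (y t)) (Icc (-N) N) t := by
  obtain ⟨k, hk⟩ := (isCompact_Icc (a := -N) (b := N)).exists_bound_of_continuousOn
    hκ.continuousOn
  obtain ⟨l, hl⟩ := (isCompact_Icc (a := -N) (b := N)).exists_bound_of_continuousOn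
    hτ.continuousOn
  have h0 : (0 : ℝ) ∈ Icc (-N) N := ⟨by linarith, hN⟩
  have hk0 : 0 ≤ k := (norm_nonneg _).trans (hk 0 h0)
  have hl0 : 0 ≤ l := (norm_nonneg _).trans (hl 0 h0)
  set φ : V → V := fun y => (max 1 ‖y‖)⁻¹ • y with hφ
  set C : ℝ := k * ‖P‖ + l * ‖Q‖ with hC
  have hC0 : 0 ≤ C := by positivity
  have hφ1 : ∀ y, ‖φ y‖ ≤ 1 := by
    intro y
    have h1 : 0 < max 1 ‖y‖ := lt_max_of_lt_left one_pos
    rw [hφ, norm_smul, norm_inv, Real.norm_of_nonneg h1.le, inv_mul_le_iff₀ h1, mul_one]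
    exact le_max_right _ _
  have hbound : ∀ t ∈ Icc (-N) N, ∀ w : V, ‖κ t • P w + τ t • Q w‖ ≤ C * ‖w‖ := by
    intro t ht w
    calc ‖κ t • P w + τ t • Q w‖ ≤ ‖κ t • P w‖ + ‖τ t • Q w‖ := norm_add_le _ _
      _ = ‖κ t‖ * ‖P w‖ + ‖τ t‖ * ‖Q w‖ := by rw [norm_smul, norm_smul]
      _ ≤ k * (‖P‖ * ‖w‖) + l * (‖Q‖ * ‖w‖) := by
          gcongr
          · exact hk t ht
          · exact P.le_opNorm w
          · exact hl t ht
          · exact Q.le_opNorm w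
      _ = C * ‖w‖ := by rw [hC]; ring
  have hPL : IsPicardLindelof (fun t y => κ t • P (φ y) + τ t • Q (φ y))
      (⟨0, h0⟩ : Icc (-N) N) x₀ ⟨C * N, by positivity⟩ 0 ⟨C, hC0⟩ ⟨C * 2, by positivity⟩ := by
    refine ⟨?_, ?_, ?_, ?_⟩
    · intro t ht
      refine (LipschitzWith.of_dist_le_mul fun y z => ?_).lipschitzOnWith
      rw [dist_eq_norm, dist_eq_norm]
      have e : κ t • P (φ y) + τ t • Q (φ y) - (κ t • P (φ z) + τ t • Q (φ z))
          = κ t • P (φ y - φ z) + τ t • Q (φ y - φ z) := by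
        simp only [map_sub, smul_sub]; abel
      rw [e]
      calc _ ≤ C * ‖φ y - φ z‖ := hbound t ht _
        _ ≤ C * (2 * ‖y - z‖) := by gcongr; exact radial_lipschitz y z
        _ = C * 2 * ‖y - z‖ := by ring
    · intro x _
      fun_prop
    · intro t ht x _
      exact (hbound t ht _).trans (mul_le_of_le_one_right hC0 (hφ1 x))
    · have e : max (N - 0) (0 - -N) = N := by simp
      change C * max (N - 0) (0 - -N) ≤ C * N - 0
      rw [e, sub_zero]
  obtain ⟨y, hy0, hy⟩ := hPL.exists_eq_forall_mem_Icc_hasDerivWithinAt₀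
  refine ⟨y, hy0, fun t ht => ?_⟩
  have hn : ∀ t ∈ Icc (-N) N, ‖y t‖ = 1 := by
    intro t ht
    have h := norm_eq_of_inner_deriv_eq_zero hy (fun t _ => by
      simp only [hφ, map_smul, inner_add_right, inner_smul_right, hP, hQ, mul_zero, add_zero]) ht
    rw [h]
    have : y 0 = x₀ := hy0
    rw [this, hx₀]
  have h := hy t ht
  have e : φ (y t) = y t := by simp [hφ, hn t ht]
  simpa only [e] using h

/-- Uniqueness for a skew linear system. -/
theorem skew_solution_unique (P Q : V →L[ℝ] V) (hP : ∀ y, inner ℝ y (P y) = 0)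
    (hQ : ∀ y, inner ℝ y (Q y) = 0) {κ τ : ℝ → ℝ} {N : ℝ} {y z : ℝ → V}
    (hy : ∀ t ∈ Icc (-N) N,
      HasDerivWithinAt y (κ t • P (y t) + τ t • Q (y t)) (Icc (-N) N) t)
    (hz : ∀ t ∈ Icc (-N) N,
      HasDerivWithinAt z (κ t • P (z t) + τ t • Q (z t)) (Icc (-N) N) t)
    (h0 : y 0 = z 0) {t : ℝ} (ht : t ∈ Icc (-N) N) : y t = z t := by
  have h := norm_eq_of_inner_deriv_eq_zero (y := fun t => y t - z t)
    (fun t ht => (hy t ht).sub (hz t ht)) (fun t _ => by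
      have e : κ t • P (y t) + τ t • Q (y t) - (κ t • P (z t) + τ t • Q (z t))
          = κ t • P (y t - z t) + τ t • Q (y t - z t) := by
        simp only [map_sub, smul_sub]; abel
      rw [e, inner_add_right, inner_smul_right, inner_smul_right, hP, hQ]
      simp) ht
  simp only [h0, sub_self, norm_zero, norm_eq_zero] at h
  exact sub_eq_zero.1 h

/-- Global existence for a skew linear system, started from a unit vector. -/
theorem exists_skew_solution [CompleteSpace V] (P Q : V →L[ℝ] V) (hP : ∀ y, inner ℝ y (P y) = 0)
    (hQ : ∀ y, inner ℝ y (Q y) = 0) {κ τ : ℝ → ℝ} (hκ : Continuous κ) (hτ : Continuous τ)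
    (x₀ : V) (hx₀ : ‖x₀‖ = 1) :
    ∃ y : ℝ → V, y 0 = x₀ ∧ ∀ t, HasDerivAt y (κ t • P (y t) + τ t • Q (y t)) t := by
  have hex := fun N : ℕ => exists_skew_solution_Icc P Q hP hQ hκ hτ x₀ hx₀
    (N := (N : ℝ) + 1) (by positivity)
  choose y hy0 hy using hex
  have hcons : ∀ N M : ℕ, N ≤ M → ∀ t ∈ Icc (-((N : ℝ) + 1)) ((N : ℝ) + 1), y N t = y M t := by
    intro N M hNM t ht
    have hNM' : (N : ℝ) ≤ M := by exact_mod_cast hNM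
    have hsub : Icc (-((N : ℝ) + 1)) ((N : ℝ) + 1) ⊆ Icc (-((M : ℝ) + 1)) ((M : ℝ) + 1) :=
      Icc_subset_Icc (by linarith) (by linarith)
    exact skew_solution_unique P Q hP hQ (hy N) (fun t ht => (hy M t (hsub ht)).mono hsub)
      ((hy0 N).trans (hy0 M).symm) ht
  refine ⟨fun t => y ⌈|t|⌉₊ t, hy0 _, fun t => ?_⟩
  set M : ℕ := ⌈|t|⌉₊ + 1 with hM
  have hMt : |t| + 1 ≤ M := by
    have := Nat.le_ceil |t|
    rw [hM]; push_cast; linarith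
  have hloc : ∀ s, |s| < |t| + 1 → y ⌈|s|⌉₊ s = y M s := by
    intro s hs
    refine hcons _ _ (Nat.ceil_le.2 (hs.le.trans hMt)) s ?_
    have := Nat.le_ceil |s|
    exact abs_le.1 (by linarith)
  have htM : |t| < (M : ℝ) + 1 := by linarith
  have hd : HasDerivAt (y M) (κ t • P (y M t) + τ t • Q (y M t)) t :=
    (hy M t (abs_le.1 htM.le)).hasDerivAt
      (Icc_mem_nhds (abs_lt.1 htM).1 (abs_lt.1 htM).2)
  have hev : (fun s => y ⌈|s|⌉₊ s) =ᶠ[𝓝 t] y M := by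
    have : ∀ᶠ s in 𝓝 t, |s| < |t| + 1 :=
      continuous_abs.continuousAt.eventually_lt continuousAt_const (by linarith)
    exact this.mono hloc
  have ht : y ⌈|t|⌉₊ t = y M t := hloc t (by linarith)
  simp only [ht]
  exact hd.congr_of_eventuallyEq hev

end Existence

/-- The curvature part of the Serret--Frenet matrix, acting on a triple `(m_j, n_j, b_j)`. -/
noncomputable def frenetP : E3 →L[ℝ] E3 :=
  (Matrix.toEuclideanCLM (𝕜 := ℝ) !![0, 1, 0; -1, 0, 0; 0, 0, 0])

/-- The torsion part of the Serret--Frenet matrix, acting on a triple `(m_j, n_j, b_j)`. -/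
noncomputable def frenetQ : E3 →L[ℝ] E3 :=
  (Matrix.toEuclideanCLM (𝕜 := ℝ) !![0, 0, 0; 0, 0, 1; 0, -1, 0])

theorem frenetP_apply (y : E3) : frenetP y = !₂[y 1, -y 0, 0] := by
  ext i
  fin_cases i <;> simp [frenetP, Matrix.mulVec, dotProduct, Fin.sum_univ_three]

theorem frenetQ_apply (y : E3) : frenetQ y = !₂[0, y 2, -y 1] := by
  ext i
  fin_cases i <;> simp [frenetQ, Matrix.mulVec, dotProduct, Fin.sum_univ_three]

theorem inner_frenetP (y : E3) : inner ℝ y (frenetP y) = 0 := by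
  rw [frenetP_apply]
  simp [PiLp.inner_apply, Fin.sum_univ_three]
  ring

theorem inner_frenetQ (y : E3) : inner ℝ y (frenetQ y) = 0 := by
  rw [frenetQ_apply]
  simp [PiLp.inner_apply, Fin.sum_univ_three]
  ring

theorem hasDerivAt_E3 {f : ℝ → E3} {f' : E3} {s : ℝ} :
    HasDerivAt f f' s ↔ ∀ i, HasDerivAt (fun s => f s i) (f' i) s := by
  simp only [← hasDerivWithinAt_univ, hasDerivWithinAt_iff_hasFDerivWithinAt]
  rw [hasFDerivWithinAt_euclidean]
  refine forall_congr' fun i => ?_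
  have e : (EuclideanSpace.proj i : E3 →L[ℝ] ℝ) ∘L ContinuousLinearMap.toSpanSingleton ℝ f'
      = ContinuousLinearMap.toSpanSingleton ℝ (f' i) := by
    ext; simp
  rw [← e]

/-- Global solvability of the Serret--Frenet system. -/
theorem exists_isFrenetFrame {κ τ : ℝ → ℝ} (hκ : Continuous κ) (hτ : Continuous τ) :
    ∃ m n b : ℝ → E3, IsFrenetFrame κ τ m n b := by
  have hex := fun j : Fin 3 => exists_skew_solution frenetP frenetQ inner_frenetP inner_frenetQ
    hκ hτ (EuclideanSpace.single j (1 : ℝ)) (by simp)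
  choose y hy0 hy using hex
  have hcoord : ∀ (j i : Fin 3) (s : ℝ), HasDerivAt (fun s => y j s i)
      ((κ s • frenetP (y j s) + τ s • frenetQ (y j s)) i) s := fun j i s =>
    (hasDerivAt_E3.1 (hy j s)) i
  refine ⟨fun s => WithLp.toLp 2 fun j => y j s 0, fun s => WithLp.toLp 2 fun j => y j s 1,
    fun s => WithLp.toLp 2 fun j => y j s 2, ?_, ?_, ?_, ?_, ?_, ?_⟩
  · intro s
    refine hasDerivAt_E3.2 fun j => ?_
    have h := hcoord j 0 s
    simpa [frenetP_apply, frenetQ_apply] using h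
  · intro s
    refine hasDerivAt_E3.2 fun j => ?_
    have h := hcoord j 1 s
    simpa [frenetP_apply, frenetQ_apply] using h
  · intro s
    refine hasDerivAt_E3.2 fun j => ?_
    have h := hcoord j 2 s
    simpa [frenetP_apply, frenetQ_apply] using h
  all_goals
    ext j
    fin_cases j <;> simp [hy0]

/-- The solution of the Serret--Frenet system is unique. -/
theorem IsFrenetFrame.unique {κ τ : ℝ → ℝ} {m n b m' n' b' : ℝ → E3}
    (h : IsFrenetFrame κ τ m n b) (h' : IsFrenetFrame κ τ m' n' b') :
    m = m' ∧ n = n' ∧ b = b' := by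
  have aux : ∀ {m n b : ℝ → E3}, IsFrenetFrame κ τ m n b → ∀ (j : Fin 3) (s : ℝ),
      HasDerivAt (fun s => (!₂[m s j, n s j, b s j] : E3))
        (κ s • frenetP !₂[m s j, n s j, b s j] + τ s • frenetQ !₂[m s j, n s j, b s j]) s := by
    intro m n b h j s
    refine hasDerivAt_E3.2 fun i => ?_
    have h1 := hasDerivAt_E3.1 (h.deriv_m s) j
    have h2 := hasDerivAt_E3.1 (h.deriv_n s) j
    have h3 := hasDerivAt_E3.1 (h.deriv_b s) j
    fin_cases i
    · simpa [frenetP_apply, frenetQ_apply] using h1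
    · simpa [frenetP_apply, frenetQ_apply] using h2
    · simpa [frenetP_apply, frenetQ_apply] using h3
  have key : ∀ (j : Fin 3) (s : ℝ),
      (!₂[m s j, n s j, b s j] : E3) = !₂[m' s j, n' s j, b' s j] := by
    intro j s
    exact skew_solution_unique frenetP frenetQ inner_frenetP inner_frenetQ (N := |s|)
      (y := fun s => (!₂[m s j, n s j, b s j] : E3))
      (z := fun s => (!₂[m' s j, n' s j, b' s j] : E3))
      (fun t _ => (aux h j t).hasDerivWithinAt) (fun t _ => (aux h' j t).hasDerivWithinAt)
      (by simp [h.m_zero, h.n_zero, h.b_zero, h'.m_zero, h'.n_zero, h'.b_zero])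
      (abs_le.1 le_rfl)
  refine ⟨?_, ?_, ?_⟩ <;> ext s j
  · simpa using congrArg (fun v : E3 => v 0) (key j s)
  · simpa using congrArg (fun v : E3 => v 1) (key j s)
  · simpa using congrArg (fun v : E3 => v 2) (key j s)

/-- The curvature `c₀ exp (-α s² / 4)` of the profile. -/
noncomputable def curvature (c₀ α s : ℝ) : ℝ := c₀ * Real.exp (-(α * s ^ 2 / 4))

/-- The torsion `β s / 2` of the profile, where `β = √(1 - α²)`. -/
noncomputable def torsion (α s : ℝ) : ℝ := Real.sqrt (1 - α ^ 2) * s / 2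

theorem exists_profile (c₀ α : ℝ) :
    ∃ m : ℝ → E3, ∃ n b : ℝ → E3, IsFrenetFrame (curvature c₀ α) (torsion α) m n b :=
  exists_isFrenetFrame (by unfold curvature; fun_prop) (by unfold torsion; fun_prop)

/-- The profile `m_{c₀,α}`: the tangent vector of the (unique) Serret--Frenet frame with
curvature `c₀ exp (-α s² / 4)` and torsion `β s / 2`. -/
noncomputable def profile (c₀ α : ℝ) : ℝ → E3 := Classical.choose (exists_profile c₀ α)

theorem profile_spec (c₀ α : ℝ) :
    ∃ n b : ℝ → E3, IsFrenetFrame (curvature c₀ α) (torsion α) (profile c₀ α) n b :=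
  Classical.choose_spec (exists_profile c₀ α)

theorem IsFrenetFrame.eq_profile {c₀ α : ℝ} {m n b : ℝ → E3}
    (h : IsFrenetFrame (curvature c₀ α) (torsion α) m n b) : m = profile c₀ α := by
  obtain ⟨n', b', h'⟩ := profile_spec c₀ α
  exact (h.unique h').1

/-- The self-similar solution `(s, t) ↦ m_{c₀,α}(s / √t)`, for `t > 0`. -/
noncomputable def selfSimilar (c₀ α s t : ℝ) : E3 := profile c₀ α (s / Real.sqrt t)

/-- `Ap` and `Am` are the vectors `A⁺_{c₀,α}` and `A⁻_{c₀,α}`: the pointwise limits of the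
self-similar solution as `t → 0⁺`, at all `s > 0` and at all `s < 0` respectively. -/
def IsInitialLimits (c₀ α : ℝ) (Ap Am : E3) : Prop :=
  (∀ s : ℝ, 0 < s → Tendsto (fun t => selfSimilar c₀ α s t) (𝓝[>] 0) (𝓝 Ap)) ∧
    ∀ s : ℝ, s < 0 → Tendsto (fun t => selfSimilar c₀ α s t) (𝓝[>] 0) (𝓝 Am)

/-! The curvature is even and the torsion odd, so `profile_neg` gives m(-s) = R m(s) with R =
diag(1, -1, -1). The two limits are therefore A and R A, where A is the limit of m at +∞, and they
differ as soon as the unit vector A leaves the first axis, that is, A₁ or A₂ is nonzero, or |A₀| < 1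
(coordinates numbered from 0). Each coordinate (m_j, n_j, b_j) of the frame solves the same skew
scalar system, so it has norm 1 and all estimates are scalar. Each regime compares m with a model.

Small c₀: to leading order n merely rotates with the torsion, and A₁ + iA₂ = c₀ J + O(c₀²), where J
= ∫ exp(-(α - iβ)s²/4) over s > 0 is a nonzero Gaussian integral (`abs_n_sub_rotation_le`).

α near 1: the torsion is negligible on compact sets and the curvature has a uniformly small tail, so
m is almost planar and A₁ is close to sin(c₀√π), nonzero by hypothesis (`abs_m_sub_planar_le`).

α near 0: the total curvature blows up, but integrating c n = -(c/τ) b' by parts shows that m varies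
by O(1/s) on [s, ∞), uniformly in α (`abs_m_sub_le_of_profile`). With continuous dependence on [0,
S] (`sq_sub_le`), A₀ is close to its value for α = 0, which `abs_limit_lt_one` places strictly
inside (-1, 1). -/

open MeasureTheory

/-! ### Scalar Serret–Frenet triples and their a priori estimates. -/

/-- A function whose derivative is dominated by that of `g` varies no more than `g`. -/
theorem abs_sub_le_of_abs_deriv_le {f g f' g' : ℝ → ℝ} {a b : ℝ} (hab : a ≤ b)
    (hf : ∀ x ∈ Icc a b, HasDerivAt f (f' x) x) (hg : ∀ x ∈ Icc a b, HasDerivAt g (g' x) x)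
    (h : ∀ x ∈ Icc a b, |f' x| ≤ g' x) : |f b - f a| ≤ g b - g a := by
  have hi : ∀ x ∈ interior (Icc a b), x ∈ Icc a b := fun x hx => interior_subset hx
  have h1 : MonotoneOn (fun x => g x - f x) (Icc a b) :=
    monotoneOn_of_hasDerivWithinAt_nonneg (convex_Icc a b)
      (fun x hx => ((hg x hx).sub (hf x hx)).continuousAt.continuousWithinAt)
      (fun x hx => ((hg x (hi x hx)).sub (hf x (hi x hx))).hasDerivWithinAt)
      (fun x hx => by linarith [(abs_le.1 (h x (hi x hx))).2])
  have h2 : MonotoneOn (fun x => g x + f x) (Icc a b) :=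
    monotoneOn_of_hasDerivWithinAt_nonneg (convex_Icc a b)
      (fun x hx => ((hg x hx).add (hf x hx)).continuousAt.continuousWithinAt)
      (fun x hx => ((hg x (hi x hx)).add (hf x (hi x hx))).hasDerivWithinAt)
      (fun x hx => by linarith [(abs_le.1 (h x (hi x hx))).1])
  have h3 := h1 (left_mem_Icc.2 hab) (right_mem_Icc.2 hab) hab
  have h4 := h2 (left_mem_Icc.2 hab) (right_mem_Icc.2 hab) hab
  simp only at h3 h4
  rw [abs_le]
  constructor <;> linarith

/-- Scalar solutions of the Serret--Frenet system, normalized to be unit vectors of `ℝ³`. -/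
structure IsFrenetTriple (κ τ m n b : ℝ → ℝ) : Prop where
  deriv_m : ∀ s, HasDerivAt m (κ s * n s) s
  deriv_n : ∀ s, HasDerivAt n (-κ s * m s + τ s * b s) s
  deriv_b : ∀ s, HasDerivAt b (-τ s * n s) s
  init : m 0 ^ 2 + n 0 ^ 2 + b 0 ^ 2 = 1

theorem IsFrenetFrame.component {κ τ : ℝ → ℝ} {m n b : ℝ → E3} (h : IsFrenetFrame κ τ m n b)
    (j : Fin 3) : IsFrenetTriple κ τ (fun s => m s j) (fun s => n s j) (fun s => b s j) where
  deriv_m s := by simpa using hasDerivAt_E3.1 (h.deriv_m s) j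
  deriv_n s := by simpa using hasDerivAt_E3.1 (h.deriv_n s) j
  deriv_b s := by simpa using hasDerivAt_E3.1 (h.deriv_b s) j
  init := by
    simp only [h.m_zero, h.n_zero, h.b_zero]
    fin_cases j <;> simp

namespace IsFrenetTriple

variable {κ τ m n b : ℝ → ℝ}

theorem sq_add_sq (h : IsFrenetTriple κ τ m n b) (s : ℝ) : m s ^ 2 + n s ^ 2 + b s ^ 2 = 1 := by
  have hd : ∀ s, HasDerivAt (fun s => m s ^ 2 + n s ^ 2 + b s ^ 2) 0 s := by
    intro s
    refine ((((h.deriv_m s).pow 2).add ((h.deriv_n s).pow 2)).add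
      ((h.deriv_b s).pow 2)).congr_deriv ?_
    simp only [Nat.cast_ofNat, Nat.add_one_sub_one, pow_one]
    ring
  rw [← h.init]
  exact is_const_of_deriv_eq_zero (fun s => (hd s).differentiableAt) (fun s => (hd s).deriv) s 0

theorem abs_m_le (h : IsFrenetTriple κ τ m n b) (s : ℝ) : |m s| ≤ 1 := by
  rw [← sq_le_one_iff_abs_le_one]
  nlinarith [h.sq_add_sq s, sq_nonneg (n s), sq_nonneg (b s)]

theorem abs_n_le (h : IsFrenetTriple κ τ m n b) (s : ℝ) : |n s| ≤ 1 := by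
  rw [← sq_le_one_iff_abs_le_one]
  nlinarith [h.sq_add_sq s, sq_nonneg (m s), sq_nonneg (b s)]

theorem abs_b_le (h : IsFrenetTriple κ τ m n b) (s : ℝ) : |b s| ≤ 1 := by
  rw [← sq_le_one_iff_abs_le_one]
  nlinarith [h.sq_add_sq s, sq_nonneg (m s), sq_nonneg (n s)]

theorem abs_deriv_m_le (h : IsFrenetTriple κ τ m n b) (hκ : ∀ s, 0 ≤ κ s) (s : ℝ) :
    |κ s * n s| ≤ κ s := by
  rw [abs_mul, abs_of_nonneg (hκ s)]
  exact mul_le_of_le_one_right (hκ s) (h.abs_n_le s)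

theorem abs_m_sub_le (h : IsFrenetTriple κ τ m n b) (hκ : ∀ s, 0 ≤ κ s) {θ : ℝ → ℝ}
    (hθ : ∀ s, HasDerivAt θ (κ s) s) {s t : ℝ} (hst : s ≤ t) : |m t - m s| ≤ θ t - θ s :=
  abs_sub_le_of_abs_deriv_le hst (fun x _ => h.deriv_m x) (fun x _ => hθ x)
    (fun x _ => h.abs_deriv_m_le hκ x)

theorem continuous_n (h : IsFrenetTriple κ τ m n b) : Continuous n :=
  continuous_iff_continuousAt.2 fun s => (h.deriv_n s).continuousAt

/-- The variation of `n cos φ - b sin φ` and `n sin φ + b cos φ`, where `φ' = τ`, is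
controlled by the total curvature. -/
theorem abs_n_sub_rotation_le (h : IsFrenetTriple κ τ m n b) (hκ : ∀ s, 0 ≤ κ s)
    {θ φ : ℝ → ℝ} (hθ : ∀ s, HasDerivAt θ (κ s) s) (hφ : ∀ s, HasDerivAt φ (τ s) s)
    (hφ0 : φ 0 = 0) {s : ℝ} (hs : 0 ≤ s) :
    |n s - (n 0 * Real.cos (φ s) + b 0 * Real.sin (φ s))| ≤ 2 * (θ s - θ 0) := by
  have hp : ∀ s, HasDerivAt (fun s => n s * Real.cos (φ s) - b s * Real.sin (φ s))
      (-κ s * m s * Real.cos (φ s)) s := fun s =>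
    (((h.deriv_n s).mul (hφ s).cos).sub ((h.deriv_b s).mul (hφ s).sin)).congr_deriv (by ring)
  have hq : ∀ s, HasDerivAt (fun s => n s * Real.sin (φ s) + b s * Real.cos (φ s))
      (-κ s * m s * Real.sin (φ s)) s := fun s =>
    (((h.deriv_n s).mul (hφ s).sin).add ((h.deriv_b s).mul (hφ s).cos)).congr_deriv (by ring)
  have hb : ∀ s x : ℝ, |x| ≤ 1 → |-κ s * m s * x| ≤ κ s := by
    intro s x hx
    rw [abs_mul, abs_mul, abs_neg, abs_of_nonneg (hκ s)]
    have := mul_le_one₀ (h.abs_m_le s) (abs_nonneg x) hx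
    nlinarith [hκ s]
  have h1 := abs_sub_le_of_abs_deriv_le hs (fun x _ => hp x) (fun x _ => hθ x)
    (fun x _ => hb x _ (Real.abs_cos_le_one _))
  have h2 := abs_sub_le_of_abs_deriv_le hs (fun x _ => hq x) (fun x _ => hθ x)
    (fun x _ => hb x _ (Real.abs_sin_le_one _))
  simp only [hφ0, Real.cos_zero, Real.sin_zero, mul_one, mul_zero, sub_zero, zero_add] at h1 h2
  set P := n s * Real.cos (φ s) - b s * Real.sin (φ s) - n 0
  set Q := n s * Real.sin (φ s) + b s * Real.cos (φ s) - b 0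
  -- Undoing the rotation mixes the two controlled errors, hence the factor 2.
  have e : n s - (n 0 * Real.cos (φ s) + b 0 * Real.sin (φ s))
      = P * Real.cos (φ s) + Q * Real.sin (φ s) := by
    linear_combination -n s * Real.sin_sq_add_cos_sq (φ s)
  rw [e]
  refine (abs_add_le _ _).trans ?_
  rw [abs_mul, abs_mul]
  have := mul_le_of_le_one_right (abs_nonneg P) (Real.abs_cos_le_one (φ s))
  have := mul_le_of_le_one_right (abs_nonneg Q) (Real.abs_sin_le_one (φ s))
  linarith

/-- If the torsion is small, then `m` is close to the planar solution. -/
theorem abs_m_sub_planar_le (h : IsFrenetTriple κ τ m n b)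
    {θ φ : ℝ → ℝ} (hθ : ∀ s, HasDerivAt θ (κ s) s) (hφ : ∀ s, HasDerivAt φ (τ s) s)
    (hθ0 : θ 0 = 0) (hτ : ∀ s, 0 ≤ s → 0 ≤ τ s) {s : ℝ} (hs : 0 ≤ s) :
    |m s - (m 0 * Real.cos (θ s) + n 0 * Real.sin (θ s))| ≤ 2 * (φ s - φ 0) := by
  -- Rotating (m, n) by the angle θ cancels the curvature terms; only torsion is left in the
  -- derivative.
  have hw : ∀ s, HasDerivAt (fun s => m s * Real.cos (θ s) - n s * Real.sin (θ s))
      (-τ s * b s * Real.sin (θ s)) s := fun s =>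
    (((h.deriv_m s).mul (hθ s).cos).sub ((h.deriv_n s).mul (hθ s).sin)).congr_deriv (by ring)
  have hv : ∀ s, HasDerivAt (fun s => m s * Real.sin (θ s) + n s * Real.cos (θ s))
      (τ s * b s * Real.cos (θ s)) s := fun s =>
    (((h.deriv_m s).mul (hθ s).sin).add ((h.deriv_n s).mul (hθ s).cos)).congr_deriv (by ring)
  have hb : ∀ s x : ℝ, 0 ≤ s → |x| ≤ 1 → |τ s * b s * x| ≤ τ s := by
    intro s x hs hx
    rw [abs_mul, abs_mul, abs_of_nonneg (hτ s hs)]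
    have := mul_le_one₀ (h.abs_b_le s) (abs_nonneg x) hx
    nlinarith [hτ s hs]
  have h1 := abs_sub_le_of_abs_deriv_le hs (fun x _ => hw x) (fun x _ => hφ x)
    (fun x hx => by
      rw [neg_mul, neg_mul, abs_neg]; exact hb x _ hx.1 (Real.abs_sin_le_one _))
  have h2 := abs_sub_le_of_abs_deriv_le hs (fun x _ => hv x) (fun x _ => hφ x)
    (fun x hx => hb x _ hx.1 (Real.abs_cos_le_one _))
  simp only [hθ0, Real.cos_zero, Real.sin_zero, mul_one, mul_zero, sub_zero, zero_add] at h1 h2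
  set P := m s * Real.cos (θ s) - n s * Real.sin (θ s) - m 0
  set Q := m s * Real.sin (θ s) + n s * Real.cos (θ s) - n 0
  have e : m s - (m 0 * Real.cos (θ s) + n 0 * Real.sin (θ s))
      = P * Real.cos (θ s) + Q * Real.sin (θ s) := by
    linear_combination -m s * Real.sin_sq_add_cos_sq (θ s)
  rw [e]
  refine (abs_add_le _ _).trans ?_
  rw [abs_mul, abs_mul]
  have := mul_le_of_le_one_right (abs_nonneg P) (Real.abs_cos_le_one (θ s))
  have := mul_le_of_le_one_right (abs_nonneg Q) (Real.abs_sin_le_one (θ s))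
  linarith

/-- Decay of the oscillation of `m`, in terms of a bound for `b` and of the ratio `ρ = κ / τ`. -/
theorem abs_m_add_sub_le (h : IsFrenetTriple κ τ m n b) {ρ ρ' : ℝ → ℝ} {ε s t : ℝ} (hst : s ≤ t)
    (hρ : ∀ x ∈ Icc s t, HasDerivAt ρ (ρ' x) x) (hρ' : ∀ x ∈ Icc s t, ρ' x ≤ 0)
    (hκ : ∀ x ∈ Icc s t, κ x = ρ x * τ x) (hb : ∀ x ∈ Icc s t, |b x| ≤ ε) :
    |(m t + ρ t * b t) - (m s + ρ s * b s)| ≤ ε * (ρ s - ρ t) := by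
  -- Integration by parts: ρ b' = -ρ τ n = -κ n cancels m', leaving ρ' b, whose integral is
  -- controlled because ρ is monotone.
  have h1 := abs_sub_le_of_abs_deriv_le (f := fun x => m x + ρ x * b x)
    (f' := fun x => ρ' x * b x) (g := fun x => -(ε * ρ x)) (g' := fun x => -(ε * ρ' x)) hst
    (fun x hx => ((h.deriv_m x).add ((hρ x hx).mul (h.deriv_b x))).congr_deriv (by
      rw [hκ x hx]; ring))
    (fun x hx => ((hρ x hx).const_mul ε).neg)
    (fun x hx => by
      rw [abs_mul, abs_of_nonpos (hρ' x hx)]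
      nlinarith [hb x hx, hρ' x hx])
  linarith

/-- Comparison of two solutions with the same initial values. -/
theorem sq_sub_le {κ₁ τ₁ m₁ n₁ b₁ : ℝ → ℝ} (h : IsFrenetTriple κ τ m n b)
    (h₁ : IsFrenetTriple κ₁ τ₁ m₁ n₁ b₁) (hm : m 0 = m₁ 0) (hn : n 0 = n₁ 0) (hb : b 0 = b₁ 0)
    {δ S : ℝ} (hS : 0 ≤ S) (hδ : ∀ s ∈ Icc 0 S, |κ s - κ₁ s| + |τ s - τ₁ s| ≤ δ) :
    (m S - m₁ S) ^ 2 ≤ 8 * δ * S := by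
  -- Derivative of the squared distance. The skew matrix applied to the difference drops out, so
  -- only the differences of coefficients remain and no Gronwall argument is needed. Each bracket is
  -- at most 4, whence |N'| ≤ 8δ.
  set N' : ℝ → ℝ := fun s => 2 * ((κ s - κ₁ s) * ((m s - m₁ s) * n₁ s - (n s - n₁ s) * m₁ s)
    + (τ s - τ₁ s) * ((n s - n₁ s) * b₁ s - (b s - b₁ s) * n₁ s)) with hN'
  have hd : ∀ s, HasDerivAt
      (fun s => (m s - m₁ s) ^ 2 + (n s - n₁ s) ^ 2 + (b s - b₁ s) ^ 2) (N' s) s := by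
    intro s
    refine (((((h.deriv_m s).sub (h₁.deriv_m s)).pow 2).add
      (((h.deriv_n s).sub (h₁.deriv_n s)).pow 2)).add
      (((h.deriv_b s).sub (h₁.deriv_b s)).pow 2)).congr_deriv ?_
    simp only [Nat.cast_ofNat, Nat.add_one_sub_one, pow_one, hN', Pi.sub_apply]
    ring
  have hdiff : ∀ x y u v p q : ℝ, |x| ≤ 1 → |y| ≤ 1 → |u| ≤ 1 → |v| ≤ 1 → |p| ≤ 1 → |q| ≤ 1 →
      |(x - y) * p - (u - v) * q| ≤ 4 := by
    intro x y u v p q hx hy hu hv hp hq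
    have h1 : |x - y| ≤ 2 := (abs_sub _ _).trans (by linarith)
    have h2 : |u - v| ≤ 2 := (abs_sub _ _).trans (by linarith)
    refine (abs_sub _ _).trans ?_
    rw [abs_mul, abs_mul]
    have := mul_le_mul h1 hp (abs_nonneg _) (by norm_num)
    have := mul_le_mul h2 hq (abs_nonneg _) (by norm_num)
    linarith
  have h2 := abs_sub_le_of_abs_deriv_le (g := fun x => 8 * δ * x) (g' := fun _ => 8 * δ) hS
    (fun x _ => hd x) (fun x _ => ((hasDerivAt_id x).const_mul (8 * δ)).congr_deriv (by simp))
    (fun x hx => by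
      have e1 := hdiff _ _ _ _ _ _ (h.abs_m_le x) (h₁.abs_m_le x) (h.abs_n_le x)
        (h₁.abs_n_le x) (h₁.abs_n_le x) (h₁.abs_m_le x)
      have e2 := hdiff _ _ _ _ _ _ (h.abs_n_le x) (h₁.abs_n_le x) (h.abs_b_le x)
        (h₁.abs_b_le x) (h₁.abs_b_le x) (h₁.abs_n_le x)
      simp only [hN']
      rw [abs_mul, abs_two]
      have e3 := abs_add_le
        ((κ x - κ₁ x) * ((m x - m₁ x) * n₁ x - (n x - n₁ x) * m₁ x))
        ((τ x - τ₁ x) * ((n x - n₁ x) * b₁ x - (b x - b₁ x) * n₁ x))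
      rw [abs_mul, abs_mul] at e3
      have := mul_le_mul_of_nonneg_left e1 (abs_nonneg (κ x - κ₁ x))
      have := mul_le_mul_of_nonneg_left e2 (abs_nonneg (τ x - τ₁ x))
      linarith [hδ x hx])
  simp only [hm, hn, hb, sub_self] at h2
  have h3 := (le_abs_self _).trans h2
  nlinarith [sq_nonneg (n S - n₁ S), sq_nonneg (b S - b₁ S)]

end IsFrenetTriple

/-! ### Primitives of curvature and torsion; the total curvature. -/

theorem curvature_nonneg {c₀ : ℝ} (hc : 0 ≤ c₀) (α s : ℝ) : 0 ≤ curvature c₀ α s :=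
  mul_nonneg hc (Real.exp_pos _).le

theorem continuous_curvature (c₀ α : ℝ) : Continuous (curvature c₀ α) := by
  unfold curvature
  fun_prop

theorem hasDerivAt_torsion_primitive (α s : ℝ) :
    HasDerivAt (fun s => Real.sqrt (1 - α ^ 2) * s ^ 2 / 4) (torsion α s) s := by
  refine (((hasDerivAt_pow 2 s).const_mul (Real.sqrt (1 - α ^ 2))).div_const 4).congr_deriv ?_
  simp only [torsion, Nat.cast_ofNat, Nat.add_one_sub_one, pow_one]
  ring

theorem hasDerivAt_integral_curvature (c₀ α s : ℝ) :
    HasDerivAt (fun s => ∫ x in (0 : ℝ)..s, curvature c₀ α x) (curvature c₀ α s) s :=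
  ((continuous_curvature c₀ α).integral_hasStrictDerivAt 0 s).hasDerivAt

theorem integrable_curvature (c₀ : ℝ) {α : ℝ} (hα : 0 < α) : Integrable (curvature c₀ α) := by
  have h := (integrable_exp_neg_mul_sq (b := α / 4) (by positivity)).const_mul c₀
  refine h.congr (Eventually.of_forall fun s => ?_)
  simp only [curvature]
  ring_nf

theorem integral_curvature (c₀ α : ℝ) :
    ∫ x in Ioi (0 : ℝ), curvature c₀ α x = c₀ * (Real.sqrt (Real.pi / (α / 4)) / 2) := by
  rw [← integral_gaussian_Ioi, ← integral_const_mul]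
  refine integral_congr_ae (Eventually.of_forall fun s => ?_)
  simp only [curvature]
  ring_nf

theorem tendsto_integral_curvature (c₀ : ℝ) {α : ℝ} (hα : 0 < α) :
    Tendsto (fun s => ∫ x in (0 : ℝ)..s, curvature c₀ α x) atTop
      (𝓝 (∫ x in Ioi (0 : ℝ), curvature c₀ α x)) :=
  intervalIntegral_tendsto_integral_Ioi 0 (integrable_curvature c₀ hα).integrableOn tendsto_id

theorem integral_curvature_le {c₀ : ℝ} (hc : 0 ≤ c₀) {α : ℝ} (hα : 0 < α) {s : ℝ} (hs : 0 ≤ s) :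
    ∫ x in (0 : ℝ)..s, curvature c₀ α x ≤ ∫ x in Ioi (0 : ℝ), curvature c₀ α x := by
  rw [intervalIntegral.integral_of_le hs]
  exact setIntegral_mono_set (integrable_curvature c₀ hα).integrableOn
    (Eventually.of_forall fun x => curvature_nonneg hc α x)
    (LE.le.eventuallyLE Ioc_subset_Ioi_self)

/-! ### Reflection symmetry, existence of the limits, and criteria for their being distinct. -/

/-- Reflection of a vector with respect to the first coordinate axis. -/
def reflectAxis (v : E3) : E3 := !₂[v 0, -v 1, -v 2]

theorem continuous_reflectAxis : Continuous reflectAxis := by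
  unfold reflectAxis
  fun_prop

/-- By uniqueness: with R the reflection, (R m(-s), -R n(-s), -R b(-s)) solves the same system with
the same initial frame. -/
theorem profile_neg (c₀ α s : ℝ) : profile c₀ α (-s) = reflectAxis (profile c₀ α s) := by
  obtain ⟨n, b, h⟩ := profile_spec c₀ α
  have hκ : ∀ s, curvature c₀ α (-s) = curvature c₀ α s := fun s => by simp [curvature]
  have hτ : ∀ s, torsion α (-s) = -torsion α s := fun s => by simp [torsion]; ring
  have comp : ∀ {f : ℝ → ℝ} {f' : ℝ} (s : ℝ), HasDerivAt f f' (-s) →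
      HasDerivAt (fun s => f (-s)) (-f') s := fun s hf =>
    (hf.comp s (hasDerivAt_neg s)).congr_deriv (by simp)
  have hr : IsFrenetFrame (curvature c₀ α) (torsion α) (fun s => reflectAxis (profile c₀ α (-s)))
      (fun s => -reflectAxis (n (-s))) (fun s => -reflectAxis (b (-s))) := by
    refine ⟨fun s => hasDerivAt_E3.2 fun i => ?_, fun s => hasDerivAt_E3.2 fun i => ?_,
      fun s => hasDerivAt_E3.2 fun i => ?_, ?_, ?_, ?_⟩
    · have h1 := comp s ((h.component i).deriv_m (-s))
      rw [hκ] at h1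
      fin_cases i
      · exact h1.congr_deriv (by simp [reflectAxis])
      · exact h1.neg.congr_deriv (by simp [reflectAxis])
      · exact h1.neg.congr_deriv (by simp [reflectAxis])
    · have h1 := comp s ((h.component i).deriv_n (-s))
      rw [hκ, hτ] at h1
      fin_cases i
      · exact h1.neg.congr_deriv (by simp [reflectAxis])
      · exact h1.neg.neg.congr_deriv (by simp [reflectAxis]; ring)
      · exact h1.neg.neg.congr_deriv (by simp [reflectAxis]; ring)
    · have h1 := comp s ((h.component i).deriv_b (-s))
      rw [hτ] at h1
      fin_cases i
      · exact h1.neg.congr_deriv (by simp [reflectAxis])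
      · exact h1.neg.neg.congr_deriv (by simp [reflectAxis])
      · exact h1.neg.neg.congr_deriv (by simp [reflectAxis])
    · ext j; fin_cases j <;> simp [reflectAxis, h.m_zero]
    · ext j; fin_cases j <;> simp [reflectAxis, h.n_zero]
    · ext j; fin_cases j <;> simp [reflectAxis, h.b_zero]
  have h2 := congrFun hr.eq_profile (-s)
  simp only [neg_neg] at h2
  exact h2.symm

/-- For α > 0 the Gaussian curvature is integrable and |n_j| ≤ 1, so m' is integrable. -/
theorem exists_tendsto_profile (c₀ : ℝ) {α : ℝ} (hα : 0 < α) :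
    ∃ A : E3, Tendsto (profile c₀ α) atTop (𝓝 A) := by
  obtain ⟨n, b, h⟩ := profile_spec c₀ α
  have hint : ∀ j, IntegrableOn (fun s => curvature c₀ α s * n s j) (Ioi 0) := fun j =>
    ((integrable_curvature c₀ hα).mul_bdd (c := 1)
      (h.component j).continuous_n.aestronglyMeasurable
      (Eventually.of_forall fun s => (h.component j).abs_n_le s)).integrableOn
  have ht := fun j => tendsto_limUnder_of_hasDerivAt_of_integrableOn_Ioi
    (fun s _ => (h.component j).deriv_m s) (hint j)
  refine ⟨WithLp.toLp 2 fun j => limUnder atTop fun s => profile c₀ α s j, ?_⟩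
  exact ((PiLp.continuous_toLp 2 _).tendsto _).comp (tendsto_pi_nhds.2 ht)

theorem isInitialLimits_of_tendsto {c₀ α : ℝ} {A : E3} (h : Tendsto (profile c₀ α) atTop (𝓝 A)) :
    IsInitialLimits c₀ α A (reflectAxis A) := by
  have hlim : ∀ s : ℝ, 0 < s → Tendsto (fun t => selfSimilar c₀ α s t) (𝓝[>] 0) (𝓝 A) := by
    intro s hs
    refine h.comp ?_
    have h0 : Tendsto Real.sqrt (𝓝[>] 0) (𝓝[>] 0) := by
      refine tendsto_nhdsWithin_iff.2 ⟨?_, ?_⟩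
      · simpa using (Real.continuous_sqrt.tendsto 0).mono_left nhdsWithin_le_nhds
      · filter_upwards [self_mem_nhdsWithin] with t ht using Real.sqrt_pos.2 ht
    simpa [div_eq_mul_inv] using (tendsto_inv_nhdsGT_zero.comp h0).const_mul_atTop hs
  refine ⟨hlim, fun s hs => ?_⟩
  have h1 := (continuous_reflectAxis.tendsto A).comp (hlim (-s) (neg_pos.2 hs))
  refine h1.congr fun t => ?_
  simp only [Function.comp_apply, selfSimilar]
  rw [← profile_neg, neg_div, neg_neg]

/-- The two initial limits differ as soon as the limit of the profile at `+∞` is not on the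
first coordinate axis. -/
theorem exists_initialLimits_ne {c₀ α : ℝ} {A : E3} (h : Tendsto (profile c₀ α) atTop (𝓝 A))
    (hA : A 1 = 0 → A 2 = 0 → False) :
    ∃ Ap Am : E3, IsInitialLimits c₀ α Ap Am ∧ Ap ≠ Am := by
  refine ⟨A, reflectAxis A, isInitialLimits_of_tendsto h, fun he => ?_⟩
  have h1 : A 1 = -A 1 := by simpa [reflectAxis] using congrArg (fun v : E3 => v 1) he
  have h2 : A 2 = -A 2 := by simpa [reflectAxis] using congrArg (fun v : E3 => v 2) he
  exact hA (by linarith) (by linarith)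

theorem tendsto_profile_apply {c₀ α : ℝ} {A : E3} (h : Tendsto (profile c₀ α) atTop (𝓝 A))
    (j : Fin 3) : Tendsto (fun s => profile c₀ α s j) atTop (𝓝 (A j)) :=
  ((EuclideanSpace.proj (𝕜 := ℝ) j).continuous.tendsto A).comp h

/-- The tangent vector of a Serret--Frenet frame is a unit vector. -/
theorem IsFrenetFrame.norm_m {κ τ : ℝ → ℝ} {m n b : ℝ → E3} (h : IsFrenetFrame κ τ m n b)
    (s : ℝ) : m s 0 ^ 2 + m s 1 ^ 2 + m s 2 ^ 2 = 1 := by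
  -- The rows of the matrix with columns m, n, b solve one skew system, so their inner products are
  -- conserved. Orthonormal rows of a square matrix force orthonormal columns.
  have hd : ∀ i j s, HasDerivAt (fun s => m s i * m s j + n s i * n s j + b s i * b s j) 0 s := by
    intro i j s
    exact ((((h.component i).deriv_m s).mul ((h.component j).deriv_m s)).add
      (((h.component i).deriv_n s).mul ((h.component j).deriv_n s))).add
      (((h.component i).deriv_b s).mul ((h.component j).deriv_b s)) |>.congr_deriv (by ring)
  set F : ℝ → Matrix (Fin 3) (Fin 3) ℝ := fun s => Matrix.of fun i => ![m s i, n s i, b s i] with hF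
  have hrow : F s * (F s).transpose = 1 := by
    ext i j
    have h1 := is_const_of_deriv_eq_zero (fun s => (hd i j s).differentiableAt)
      (fun s => (hd i j s).deriv) s 0
    have h2 : (F s * (F s).transpose) i j = m s i * m s j + n s i * n s j + b s i * b s j := by
      simp [hF, Matrix.mul_apply, Fin.sum_univ_three]
    rw [h2, h1, h.m_zero, h.n_zero, h.b_zero]
    fin_cases i <;> fin_cases j <;> simp
  have hone : (F s).transpose * F s = 1 := mul_eq_one_comm.1 hrow
  have hcol := congrFun (congrFun hone 0) 0
  simp only [Matrix.mul_apply, Fin.sum_univ_three, Matrix.transpose_apply, hF, Matrix.of_apply,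
    Matrix.cons_val_zero, Matrix.one_apply_eq] at hcol
  linarith

/-- The two initial limits differ as soon as the first coordinate of the limit of the profile
at `+∞` is less than `1` in absolute value. -/
theorem exists_initialLimits_ne_of_abs_lt {c₀ α : ℝ} {A : E3}
    (h : Tendsto (profile c₀ α) atTop (𝓝 A)) (hA : |A 0| < 1) :
    ∃ Ap Am : E3, IsInitialLimits c₀ α Ap Am ∧ Ap ≠ Am := by
  refine exists_initialLimits_ne h fun h1 h2 => ?_
  obtain ⟨n, b, hF⟩ := profile_spec c₀ α
  have hlim := ((tendsto_profile_apply h 0).pow 2).add ((tendsto_profile_apply h 1).pow 2) |>.add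
    ((tendsto_profile_apply h 2).pow 2)
  have h3 := tendsto_nhds_unique (hlim.congr hF.norm_m) tendsto_const_nhds
  rw [h1, h2] at h3
  have := (sq_lt_one_iff_abs_lt_one _).2 hA
  linarith

/-! ### Small curvature: first-order expansion in c₀. -/

theorem initialLimits_ne_of_small_curvature {α : ℝ} (hα : 0 < α) :
    ∃ cstar : ℝ, 0 < cstar ∧ ∀ c₀ : ℝ, 0 < c₀ → c₀ < cstar →
      ∃ Ap Am : E3, IsInitialLimits c₀ α Ap Am ∧ Ap ≠ Am := by
  set β := Real.sqrt (1 - α ^ 2) with hβ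
  -- Chosen so that exp(-z s²) carries both the Gaussian factor of the curvature and the phase βs²/4
  -- of the torsion.
  set z : ℂ := ⟨α / 4, -(β / 4)⟩ with hz
  have hzre : 0 < z.re := by simp only [hz]; positivity
  set J : ℂ := ∫ x : ℝ in Ioi 0, Complex.exp (-z * x ^ 2) with hJ
  have hJ0 : 0 < ‖J‖ := by
    rw [norm_pos_iff, hJ, integral_gaussian_complex_Ioi hzre]
    have hz0 : z ≠ 0 := fun h => by simp [h] at hzre
    have : (Real.pi / z : ℂ) ≠ 0 := div_ne_zero (by exact_mod_cast Real.pi_ne_zero) hz0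
    exact div_ne_zero (fun h => this ((Complex.cpow_eq_zero_iff _ _).1 h).1) two_ne_zero
  set G : ℝ := Real.sqrt (Real.pi / (α / 4)) / 2 with hG
  have hG0 : 0 < G := by
    have := Real.pi_pos
    positivity
  -- c₀ G is the total curvature on the half-line. If A were on the axis, the first-order term c₀ J
  -- would be at most the error c₀ G · 4c₀ G; this threshold excludes that.
  refine ⟨‖J‖ / (4 * G ^ 2), by positivity, fun c₀ hc hlt => ?_⟩
  obtain ⟨A, hA⟩ := exists_tendsto_profile c₀ hα
  refine exists_initialLimits_ne hA fun hA1 hA2 => ?_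
  obtain ⟨n, b, hF⟩ := profile_spec c₀ α
  set m := profile c₀ α
  have hκ := curvature_nonneg hc.le α
  have hθ := hasDerivAt_integral_curvature c₀ α
  have hφ := hasDerivAt_torsion_primitive α
  have hΘ : ∀ s, 0 ≤ s → ∫ x in (0 : ℝ)..s, curvature c₀ α x ≤ c₀ * G := fun s hs => by
    rw [hG, ← integral_curvature]
    exact integral_curvature_le hc.le hα hs
  have hn1 : ∀ s, 0 ≤ s → |n s 1 - Real.cos (β * s ^ 2 / 4)| ≤ 2 * (c₀ * G) := fun s hs => by
    have h1 := (hF.component 1).abs_n_sub_rotation_le hκ hθ hφ (by simp) hs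
    have h2 := hΘ s hs
    simp only [hF.n_zero, hF.b_zero, intervalIntegral.integral_same] at h1
    simp at h1
    linarith
  have hn2 : ∀ s, 0 ≤ s → |n s 2 - Real.sin (β * s ^ 2 / 4)| ≤ 2 * (c₀ * G) := fun s hs => by
    have h1 := (hF.component 2).abs_n_sub_rotation_le hκ hθ hφ (by simp) hs
    have h2 := hΘ s hs
    simp only [hF.n_zero, hF.b_zero, intervalIntegral.integral_same] at h1
    simp at h1
    linarith
  have hd : ∀ s, HasDerivAt (fun s => ((m s 1 : ℝ) : ℂ) + (m s 2 : ℝ) * Complex.I)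
      ((curvature c₀ α s : ℂ) * ((n s 1 : ℝ) + (n s 2 : ℝ) * Complex.I)) s := fun s =>
    (((hF.component 1).deriv_m s).ofReal_comp.add
      (((hF.component 2).deriv_m s).ofReal_comp.mul_const Complex.I)).congr_deriv
      (by push_cast; ring)
  have hnc : Continuous fun s => ((n s 1 : ℝ) : ℂ) + (n s 2 : ℝ) * Complex.I :=
    (Complex.continuous_ofReal.comp (hF.component 1).continuous_n).add
      ((Complex.continuous_ofReal.comp (hF.component 2).continuous_n).mul continuous_const)
  have hint : Integrable fun s =>
      (curvature c₀ α s : ℂ) * (((n s 1 : ℝ) : ℂ) + (n s 2 : ℝ) * Complex.I) := by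
    refine (integrable_curvature c₀ hα).ofReal.mul_bdd (c := 2) hnc.aestronglyMeasurable
      (Eventually.of_forall fun s => (norm_add_le _ _).trans ?_)
    have h1 := (hF.component 1).abs_n_le s
    have h2 := (hF.component 2).abs_n_le s
    simp only [norm_mul, Complex.norm_I, mul_one, Complex.norm_real, Real.norm_eq_abs]
    linarith
  have hlim : Tendsto (fun s => ((m s 1 : ℝ) : ℂ) + (m s 2 : ℝ) * Complex.I) atTop (𝓝 0) := by
    have h1 := ((Complex.continuous_ofReal.tendsto _).comp (tendsto_profile_apply hA 1)).add
      (((Complex.continuous_ofReal.tendsto _).comp (tendsto_profile_apply hA 2)).mul_const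
        Complex.I)
    rw [hA1, hA2] at h1
    simpa using h1
  -- The combination m₁ + i m₂ vanishes at 0, and at infinity by assumption, so the integral of c
  -- (n₁ + i n₂) is zero.
  have hzero := integral_Ioi_of_hasDerivAt_of_tendsto (a := 0)
    (hd 0).continuousAt.continuousWithinAt (fun s _ => hd s) hint.integrableOn hlim
  simp only [hF.m_zero] at hzero
  simp at hzero
  have hexp : ∀ s : ℝ, (c₀ : ℂ) * Complex.exp (-z * s ^ 2) = (curvature c₀ α s : ℂ) *
      ((Real.cos (β * s ^ 2 / 4) : ℝ) + (Real.sin (β * s ^ 2 / 4) : ℝ) * Complex.I) := by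
    intro s
    have e : -z * (s : ℂ) ^ 2
        = ((-(α * s ^ 2 / 4) : ℝ) : ℂ) + ((β * s ^ 2 / 4 : ℝ) : ℂ) * Complex.I := by
      apply Complex.ext <;> simp [hz, pow_two] <;> ring
    rw [e, Complex.exp_add, Complex.exp_mul_I, curvature]
    push_cast
    ring
  have hintJ : Integrable fun s : ℝ => (c₀ : ℂ) * Complex.exp (-z * s ^ 2) :=
    (integrable_cexp_neg_mul_sq hzre).const_mul _
  have hdiff : (c₀ : ℂ) * J = ∫ s : ℝ in Ioi 0, ((c₀ : ℂ) * Complex.exp (-z * s ^ 2) -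
      (curvature c₀ α s : ℂ) * (((n s 1 : ℝ) : ℂ) + (n s 2 : ℝ) * Complex.I)) := by
    rw [integral_sub hintJ.integrableOn hint.integrableOn, hzero, sub_zero, hJ,
      integral_const_mul]
  have hbound : ‖(c₀ : ℂ) * J‖ ≤ ∫ s : ℝ in Ioi 0, curvature c₀ α s * (4 * (c₀ * G)) := by
    rw [hdiff]
    refine norm_integral_le_of_norm_le ((integrable_curvature c₀ hα).mul_const _).integrableOn ?_
    filter_upwards [ae_restrict_mem measurableSet_Ioi] with s hs
    have hs0 : 0 ≤ s := le_of_lt hs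
    rw [hexp, ← mul_sub, norm_mul, Complex.norm_real, Real.norm_of_nonneg (hκ s)]
    refine mul_le_mul_of_nonneg_left ?_ (hκ s)
    have e : ((Real.cos (β * s ^ 2 / 4) : ℝ) : ℂ) + (Real.sin (β * s ^ 2 / 4) : ℝ) * Complex.I
        - (((n s 1 : ℝ) : ℂ) + (n s 2 : ℝ) * Complex.I)
        = -((n s 1 - Real.cos (β * s ^ 2 / 4) : ℝ) : ℂ)
          + -((n s 2 - Real.sin (β * s ^ 2 / 4) : ℝ) : ℂ) * Complex.I := by
      push_cast; ring
    rw [e]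
    refine (norm_add_le _ _).trans ?_
    simp only [norm_mul, norm_neg, Complex.norm_I, mul_one, Complex.norm_real, Real.norm_eq_abs]
    linarith [hn1 s hs0, hn2 s hs0]
  rw [integral_mul_const, integral_curvature, ← hG, norm_mul, Complex.norm_real,
    Real.norm_of_nonneg hc.le] at hbound
  rw [lt_div_iff₀ (by positivity)] at hlt
  nlinarith

/-! ### Damping near 1: comparison with the planar curve. -/

theorem initialLimits_ne_of_damping_near_one {c₀ : ℝ} (hc : 0 < c₀)
    (hk : ∀ k : ℕ, c₀ ≠ k * Real.sqrt Real.pi) :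
    ∃ α₁ : ℝ, 0 < α₁ ∧ α₁ < 1 ∧ ∀ α : ℝ, α₁ < α → α < 1 →
      ∃ Ap Am : E3, IsInitialLimits c₀ α Ap Am ∧ Ap ≠ Am := by
  set Θ : ℝ → ℝ := fun α => c₀ * (Real.sqrt (Real.pi / (α / 4)) / 2) with hΘ
  have hπ : 0 < Real.sqrt Real.pi := Real.sqrt_pos.2 Real.pi_pos
  have hΘ1 : Θ 1 = c₀ * Real.sqrt Real.pi := by
    have : Real.pi / (1 / 4) = Real.pi * 2 ^ 2 := by ring
    simp only [hΘ]
    rw [this, Real.sqrt_mul Real.pi_pos.le, Real.sqrt_sq two_pos.le]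
    ring
  have hsin : Real.sin (Θ 1) ≠ 0 := by
    rw [hΘ1]
    intro h0
    obtain ⟨k, hk'⟩ := Real.sin_eq_zero_iff.1 h0
    have h1 : c₀ = k * Real.sqrt Real.pi := by
      refine mul_right_cancel₀ hπ.ne' ?_
      rw [← hk', mul_assoc, Real.mul_self_sqrt Real.pi_pos.le]
    have hk0 : 0 ≤ k := by
      by_contra hneg
      have : (k : ℝ) < 0 := by exact_mod_cast not_le.1 hneg
      nlinarith
    lift k to ℕ using hk0
    exact hk k (by exact_mod_cast h1)
  set δ := |Real.sin (Θ 1)| with hδ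
  have hδ0 : 0 < δ := abs_pos.2 hsin
  -- The curvature decreases in α, so the tail at α = 1/2 dominates those of all α > 1/2 and S is
  -- independent of α.
  obtain ⟨S, hS0, hS⟩ : ∃ S : ℝ, 0 ≤ S ∧
      ∫ x in Ioi S, curvature c₀ (1 / 2) x < δ / 8 := by
    have h1 := (tendsto_integral_curvature c₀ (α := 1 / 2) (by norm_num)).eventually
      (eventually_gt_nhds (show (∫ x in Ioi (0 : ℝ), curvature c₀ (1 / 2) x) - δ / 8 <
        ∫ x in Ioi (0 : ℝ), curvature c₀ (1 / 2) x by linarith))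
    obtain ⟨S, hS0, hS⟩ := ((eventually_ge_atTop (0 : ℝ)).and h1).exists
    refine ⟨S, hS0, ?_⟩
    have h2 := intervalIntegral.integral_Ioi_sub_Ioi (f := curvature c₀ (1 / 2)) (μ := volume)
      (integrable_curvature c₀ (by norm_num)).integrableOn hS0
    linarith
  have hcont : ContinuousAt (fun α => |Real.sin (Θ α)|) 1 := by
    simp only [hΘ]
    fun_prop (disch := norm_num)
  have hcontβ : Continuous fun α : ℝ => 2 * (Real.sqrt (1 - α ^ 2) * S ^ 2 / 4) := by fun_prop
  -- Error budget: if A₁ = 0, then |sin Θ(α)| is below two tails plus the planar error, 3δ/8 in all,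
  -- contradicting the lower bound δ/2.
  have hev : ∀ᶠ α in 𝓝 (1 : ℝ), 1 / 2 < α ∧ δ / 2 < |Real.sin (Θ α)| ∧
      2 * (Real.sqrt (1 - α ^ 2) * S ^ 2 / 4) < δ / 8 :=
    (eventually_gt_nhds (by norm_num)).and
      ((hcont.eventually (eventually_gt_nhds (by simp only [← hδ]; linarith))).and
      (hcontβ.continuousAt.eventually (eventually_lt_nhds (by simp; linarith))))
  obtain ⟨l, hl, hsub⟩ := exists_Ioc_subset_of_mem_nhds hev ⟨0, one_pos⟩
  refine ⟨max l (1 / 2), by positivity, max_lt hl (by norm_num), fun α hα1 hα2 => ?_⟩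
  obtain ⟨hα, hs, hβ⟩ := hsub ⟨(le_max_left _ _).trans_lt hα1, hα2.le⟩
  have hα0 : 0 < α := by linarith
  obtain ⟨A, hA⟩ := exists_tendsto_profile c₀ hα0
  refine exists_initialLimits_ne hA fun hA1 _ => ?_
  obtain ⟨n, b, hF⟩ := profile_spec c₀ α
  have hκ := curvature_nonneg hc.le α
  have hθ := hasDerivAt_integral_curvature c₀ α
  have hplanar := (hF.component 1).abs_m_sub_planar_le hθ (hasDerivAt_torsion_primitive α)
    (by simp) (fun s hs => by unfold torsion; positivity) hS0
  simp only [hF.m_zero, hF.n_zero] at hplanar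
  simp at hplanar
  set θ : ℝ → ℝ := fun s => ∫ x in (0 : ℝ)..s, curvature c₀ α x with hθd
  have hθlim : Tendsto θ atTop (𝓝 (Θ α)) := by
    have := tendsto_integral_curvature c₀ hα0
    rwa [integral_curvature] at this
  have htail : Θ α - θ S < δ / 8 := by
    have h2 := intervalIntegral.integral_Ioi_sub_Ioi (f := curvature c₀ α) (μ := volume)
      (integrable_curvature c₀ hα0).integrableOn hS0
    rw [integral_curvature] at h2
    have h3 : ∫ x in Ioi S, curvature c₀ α x ≤ ∫ x in Ioi S, curvature c₀ (1 / 2) x := by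
      refine setIntegral_mono (integrable_curvature c₀ hα0).integrableOn
        (integrable_curvature c₀ (by norm_num)).integrableOn fun x => ?_
      unfold curvature
      gcongr
    simp only [hθd, hΘ]
    linarith
  have h1 : |0 - profile c₀ α S 1| ≤ Θ α - θ S := by
    rw [← hA1]
    refine le_of_tendsto_of_tendsto ((tendsto_profile_apply hA 1).sub_const _).abs
      (hθlim.sub_const _) ?_
    filter_upwards [eventually_ge_atTop S] with t ht
    exact (hF.component 1).abs_m_sub_le hκ hθ ht
  have h2 : |Real.sin (Θ α) - Real.sin (θ S)| ≤ Θ α - θ S := by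
    refine le_of_tendsto_of_tendsto (((Real.continuous_sin.tendsto _).comp hθlim).sub_const _).abs
      (hθlim.sub_const _) ?_
    filter_upwards [eventually_ge_atTop S] with t ht
    exact abs_sub_le_of_abs_deriv_le (f := fun t => Real.sin (θ t)) ht
      (fun x _ => (hθ x).sin) (fun x _ => hθ x) (fun x _ => by
        rw [abs_mul, abs_of_nonneg (hκ x)]
        exact mul_le_of_le_one_left (hκ x) (Real.abs_cos_le_one _))
  have h3 : |Real.sin (Θ α)| ≤ |Real.sin (Θ α) - Real.sin (θ S)|
      + |profile c₀ α S 1 - Real.sin (θ S)| + |0 - profile c₀ α S 1| := by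
    have e : Real.sin (Θ α) = (Real.sin (Θ α) - Real.sin (θ S))
      - (profile c₀ α S 1 - Real.sin (θ S)) - (0 - profile c₀ α S 1) := by ring
    calc |Real.sin (Θ α)| = _ := congrArg _ e
      _ ≤ _ := (abs_sub _ _).trans (by gcongr; exact abs_sub _ _)
  linarith

/-! ### Small damping: uniform tails and the undamped profile. -/

/-- The derivative of the ratio between curvature and torsion. -/
theorem hasDerivAt_exp_div (k α : ℝ) {x : ℝ} (hx : 0 < x) :
    HasDerivAt (fun x => k * (Real.exp (-(α * x ^ 2 / 4)) / x))
      (k * (-(Real.exp (-(α * x ^ 2 / 4)) * (α * x ^ 2 / 2 + 1)) / x ^ 2)) x := by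
  have h1 : HasDerivAt (fun x : ℝ => -(α * x ^ 2 / 4)) (-(α * x / 2)) x := by
    refine ((((hasDerivAt_pow 2 x).const_mul α).div_const 4).neg).congr_deriv ?_
    simp only [Nat.cast_ofNat, Nat.add_one_sub_one, pow_one]
    ring
  refine ((h1.exp.div (hasDerivAt_id x) hx.ne').const_mul k).congr_deriv ?_
  simp only [id]
  ring

theorem exp_div_deriv_nonpos {k α x : ℝ} (hk : 0 ≤ k) (hα : 0 ≤ α) :
    k * (-(Real.exp (-(α * x ^ 2 / 4)) * (α * x ^ 2 / 2 + 1)) / x ^ 2) ≤ 0 := by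
  rw [neg_div, mul_neg]
  have : 0 ≤ k * ((Real.exp (-(α * x ^ 2 / 4)) * (α * x ^ 2 / 2 + 1)) / x ^ 2) := by positivity
  linarith

/-- Here ρ is the ratio of curvature to torsion, which decreases on s > 0. Keeping ε general
matters: ε = 1 gives the uniform tail, while small ε gives the o(1/s) decay needed when α = 0. -/
theorem IsFrenetTriple.abs_m_add_sub_le_of_profile {c₀ α : ℝ} {m n b : ℝ → ℝ}
    (h : IsFrenetTriple (curvature c₀ α) (torsion α) m n b) (hc : 0 ≤ c₀) (hα : 0 ≤ α)
    (hα1 : α < 1) {k ε s t : ℝ} (hk : k = 2 * c₀ / Real.sqrt (1 - α ^ 2)) (hs : 0 < s)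
    (hst : s ≤ t) (hb : ∀ x ∈ Icc s t, |b x| ≤ ε) :
    |(m t + k * (Real.exp (-(α * t ^ 2 / 4)) / t) * b t)
      - (m s + k * (Real.exp (-(α * s ^ 2 / 4)) / s) * b s)|
      ≤ ε * (k * (Real.exp (-(α * s ^ 2 / 4)) / s) - k * (Real.exp (-(α * t ^ 2 / 4)) / t)) := by
  have hβ : 0 < Real.sqrt (1 - α ^ 2) := Real.sqrt_pos.2 (by nlinarith)
  have hk0 : 0 ≤ k := by rw [hk]; positivity
  refine h.abs_m_add_sub_le (ρ := fun x => k * (Real.exp (-(α * x ^ 2 / 4)) / x)) hst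
    (fun x hx => hasDerivAt_exp_div k α (hs.trans_le hx.1))
    (fun x _ => exp_div_deriv_nonpos hk0 hα) (fun x hx => ?_) hb
  have hx0 : 0 < x := hs.trans_le hx.1
  simp only [curvature, torsion, hk]
  field_simp

/-- The variation of `m` on `[s, ∞)` is `O(1 / s)`, uniformly for `α` away from `1`. -/
theorem IsFrenetTriple.abs_m_sub_le_of_profile {c₀ α : ℝ} {m n b : ℝ → ℝ}
    (h : IsFrenetTriple (curvature c₀ α) (torsion α) m n b) (hc : 0 ≤ c₀) (hα : 0 ≤ α)
    (hα1 : α ≤ 1 / 2) {s t : ℝ} (hs : 0 < s) (hst : s ≤ t) :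
    |m t - m s| ≤ 8 * c₀ / s := by
  have hβ : 1 / 2 ≤ Real.sqrt (1 - α ^ 2) := Real.le_sqrt_of_sq_le (by nlinarith)
  have hβ0 : 0 < Real.sqrt (1 - α ^ 2) := by linarith
  set k := 2 * c₀ / Real.sqrt (1 - α ^ 2) with hk
  have hk4 : k ≤ 4 * c₀ := by
    rw [hk, div_le_iff₀ hβ0]
    nlinarith
  have hk0 : 0 ≤ k := by positivity
  have ht : 0 < t := hs.trans_le hst
  have h1 := h.abs_m_add_sub_le_of_profile hc hα (by linarith) hk hs hst
    (fun x _ => h.abs_b_le x)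
  have hr : ∀ x : ℝ, 0 < x → 0 ≤ k * (Real.exp (-(α * x ^ 2 / 4)) / x) := fun x hx => by
    positivity
  have hrs : k * (Real.exp (-(α * s ^ 2 / 4)) / s) ≤ 4 * c₀ / s := by
    rw [← mul_div_assoc]
    refine div_le_div_of_nonneg_right ?_ hs.le
    exact (mul_le_of_le_one_right hk0 (Real.exp_le_one_iff.2 (by
      have : 0 ≤ α * s ^ 2 / 4 := by positivity
      linarith))).trans hk4
  -- The boundary terms ρ(s) and ρ(t) plus the integral bound ρ(s) - ρ(t) add up to 2ρ(s).
  have e : 8 * c₀ / s = 2 * (4 * c₀ / s) := by ring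
  have hbs := abs_le.1 (h.abs_b_le s)
  have hbt := abs_le.1 (h.abs_b_le t)
  have h2 := abs_le.1 h1
  have hs0 := hr s hs
  have ht0 := hr t ht
  set p := k * (Real.exp (-(α * s ^ 2 / 4)) / s)
  set q := k * (Real.exp (-(α * t ^ 2 / 4)) / t)
  have := mul_le_mul_of_nonneg_left hbs.1 hs0
  have := mul_le_mul_of_nonneg_left hbs.2 hs0
  have := mul_le_mul_of_nonneg_left hbt.1 ht0
  have := mul_le_mul_of_nonneg_left hbt.2 ht0
  rw [abs_le]
  constructor <;> linarith

/-- For the undamped profile (`α = 0`), the limit of the first coordinate of the tangent vector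
is less than `1` in absolute value. -/
theorem IsFrenetTriple.abs_limit_lt_one {c₀ : ℝ} {m n b : ℝ → ℝ}
    (h : IsFrenetTriple (curvature c₀ 0) (torsion 0) m n b) (hc : 0 < c₀) (hb0 : b 0 = 0)
    {A : ℝ} (hA : Tendsto m atTop (𝓝 A)) : |A| < 1 := by
  have hκ : ∀ s, curvature c₀ 0 s = c₀ := fun s => by simp [curvature]
  have hτ : ∀ s, torsion 0 s = s / 2 := fun s => by simp [torsion]
  have hA1 : |A| ≤ 1 := le_of_tendsto hA.abs (Eventually.of_forall h.abs_m_le)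
  refine lt_of_le_of_ne hA1 fun hAeq => ?_
  have hAA : A * A = 1 := by rw [← abs_mul_abs_self, hAeq, one_mul]
  have hbt : Tendsto (fun s => |b s|) atTop (𝓝 0) := by
    have h1 : Tendsto (fun s => Real.sqrt (1 - m s ^ 2)) atTop (𝓝 0) := by
      have := ((hA.pow 2).const_sub 1).sqrt
      rwa [pow_two, hAA, sub_self, Real.sqrt_zero] at this
    refine squeeze_zero (fun s => abs_nonneg _) (fun s => Real.abs_le_sqrt ?_) h1
    nlinarith [h.sq_add_sq s, sq_nonneg (n s)]
  -- The n terms cancel in F', leaving (m - A)/2. When |A| = 1 this has a fixed sign, while the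
  -- o(1/s) tail estimate sends F to 0 at infinity.
  set F : ℝ → ℝ := fun s => c₀ * b s + s / 2 * (m s - A) with hF
  have hFd : ∀ s, HasDerivAt F ((m s - A) / 2) s := fun s =>
    (((h.deriv_b s).const_mul c₀).add
      (((hasDerivAt_id s).div_const 2).mul ((h.deriv_m s).sub_const A))).congr_deriv (by
        rw [hκ, hτ]; simp only [id]; ring)
  have hFlim : Tendsto F atTop (𝓝 0) := by
    rw [Metric.tendsto_atTop]
    intro ε hε
    obtain ⟨S, hS⟩ := eventually_atTop.1
      (hbt.eventually (eventually_lt_nhds (show (0 : ℝ) < ε / (2 * c₀) by positivity)))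
    refine ⟨max S 1, fun s hs => ?_⟩
    have hs0 : 0 < s := one_pos.trans_le ((le_max_right _ _).trans hs)
    have hlim0 : Tendsto (fun t : ℝ => 2 * c₀ * (1 / t)) atTop (𝓝 0) := by
      simpa using tendsto_inv_atTop_zero.const_mul (2 * c₀)
    have hlimb : Tendsto (fun t => 2 * c₀ * (1 / t) * b t) atTop (𝓝 0) := by
      simpa using hlim0.mul ((tendsto_zero_iff_abs_tendsto_zero _).2 hbt)
    have h1 : |(A + 0) - (m s + 2 * c₀ * (1 / s) * b s)|
        ≤ ε / (2 * c₀) * (2 * c₀ * (1 / s) - 0) := by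
      refine le_of_tendsto_of_tendsto ((hA.add hlimb).sub_const _).abs
        ((hlim0.const_sub _).const_mul _) ?_
      filter_upwards [eventually_ge_atTop s] with t ht
      have h2 := h.abs_m_add_sub_le_of_profile (k := 2 * c₀) hc.le le_rfl one_pos (by simp)
        hs0 ht (fun x hx => (hS x ((le_max_left _ _).trans (hs.trans hx.1))).le)
      simpa using h2
    have e : F s = -(s / 2) * ((A + 0) - (m s + 2 * c₀ * (1 / s) * b s)) := by
      simp only [hF]
      field_simp
      ring
    rw [Real.dist_eq, sub_zero, e, abs_mul, abs_neg, abs_of_pos (by positivity)]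
    calc s / 2 * |(A + 0) - (m s + 2 * c₀ * (1 / s) * b s)|
        ≤ s / 2 * (ε / (2 * c₀) * (2 * c₀ * (1 / s) - 0)) := by gcongr
      _ = ε / 2 := by field_simp; ring
      _ < ε := by linarith
  -- A F is nonincreasing, starts at 0 because b(0) = 0, and tends to 0; so F vanishes on [0, ∞) and
  -- m is constant there.
  have hanti : Antitone fun s => A * F s := by
    refine antitone_of_hasDerivAt_nonpos (fun s => (hFd s).const_mul A) fun s => ?_
    have h1 : A * m s ≤ 1 := by
      refine (le_abs_self _).trans ?_
      rw [abs_mul, hAeq, one_mul]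
      exact h.abs_m_le s
    simp only [Pi.zero_apply]
    nlinarith
  have hF0 : F 0 = 0 := by simp [hF, hb0]
  have hAF : ∀ s, 0 ≤ s → A * F s = 0 := by
    intro s hs
    refine le_antisymm (by simpa [hF0] using hanti hs) ?_
    have h1 := hFlim.const_mul A
    rw [mul_zero] at h1
    refine le_of_tendsto h1 ?_
    filter_upwards [eventually_ge_atTop s] with t ht using hanti ht
  have hA0 : A ≠ 0 := fun h0 => by simp [h0] at hAA
  have hmA : ∀ s, 0 < s → m s = A := by
    intro s hs
    have hev : F =ᶠ[𝓝 s] fun _ => 0 := by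
      filter_upwards [lt_mem_nhds hs] with t ht
      exact (mul_eq_zero.1 (hAF t ht.le)).resolve_left hA0
    have := (hFd s).unique ((hasDerivAt_const s (0 : ℝ)).congr_of_eventuallyEq hev)
    linarith
  have hn : ∀ s, 0 < s → n s = 0 ∧ b s = 0 := by
    intro s hs
    have h1 := h.sq_add_sq s
    rw [hmA s hs] at h1
    constructor <;> nlinarith [sq_nonneg (n s), sq_nonneg (b s)]
  -- With n = b = 0 and m = A, the equation for n' reads 0 = -c₀ A, which is absurd.
  have hev : n =ᶠ[𝓝 1] fun _ => 0 := by
    filter_upwards [lt_mem_nhds one_pos] with t ht using (hn t ht).1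
  have h1 := (h.deriv_n 1).unique ((hasDerivAt_const 1 (0 : ℝ)).congr_of_eventuallyEq hev)
  rw [hmA 1 one_pos, (hn 1 one_pos).2, hκ, mul_zero, add_zero] at h1
  rcases mul_eq_zero.1 h1 with h2 | h2
  · linarith
  · exact hA0 h2

/-- From 1 - exp(-x) ≤ x and 1 - √(1 - α²) ≤ α; this feeds `sq_sub_le`. -/
theorem abs_curvature_sub_add_abs_torsion_sub_le {c₀ α s S : ℝ} (hc : 0 ≤ c₀) (hα : 0 ≤ α)
    (hα1 : α ≤ 1) (hs : s ∈ Icc 0 S) :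
    |curvature c₀ α s - curvature c₀ 0 s| + |torsion α s - torsion 0 s|
      ≤ α * (c₀ * S ^ 2 + S) := by
  have hS : 0 ≤ S := hs.1.trans hs.2
  have h1 : |curvature c₀ α s - curvature c₀ 0 s| ≤ α * (c₀ * S ^ 2) := by
    have e : curvature c₀ α s - curvature c₀ 0 s = -(c₀ * (1 - Real.exp (-(α * s ^ 2 / 4)))) := by
      simp [curvature]; ring
    have h2 := Real.add_one_le_exp (-(α * s ^ 2 / 4))
    have h3 : s ^ 2 ≤ S ^ 2 := pow_le_pow_left₀ hs.1 hs.2 2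
    have h4 := mul_le_mul_of_nonneg_left h3 hα
    have h5 : Real.exp (-(α * s ^ 2 / 4)) ≤ 1 := Real.exp_le_one_iff.2 (by
      have : 0 ≤ α * s ^ 2 / 4 := by positivity
      linarith)
    have h6 : 0 ≤ α * S ^ 2 := by positivity
    rw [e, abs_neg, abs_of_nonneg (mul_nonneg hc (by linarith))]
    calc c₀ * (1 - Real.exp (-(α * s ^ 2 / 4))) ≤ c₀ * (α * S ^ 2) := by
          gcongr; linarith
      _ = α * (c₀ * S ^ 2) := by ring
  have h2 : |torsion α s - torsion 0 s| ≤ α * S := by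
    have e : torsion α s - torsion 0 s = -((1 - Real.sqrt (1 - α ^ 2)) * s / 2) := by
      simp [torsion]; ring
    have h3 : 1 - α ≤ Real.sqrt (1 - α ^ 2) := Real.le_sqrt_of_sq_le (by nlinarith)
    have h4 : Real.sqrt (1 - α ^ 2) ≤ 1 := Real.sqrt_le_one.2 (by nlinarith)
    have h5 : (1 - Real.sqrt (1 - α ^ 2)) * s ≤ α * S :=
      mul_le_mul (by linarith) hs.2 hs.1 hα
    have h6 : 0 ≤ (1 - Real.sqrt (1 - α ^ 2)) * s := mul_nonneg (by linarith) hs.1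
    rw [e, abs_neg, abs_of_nonneg (by linarith)]
    linarith
  linarith

theorem initialLimits_ne_of_small_damping {c₀ : ℝ} (hc : 0 < c₀) :
    ∃ α₀ : ℝ, 0 < α₀ ∧ α₀ < 1 ∧ ∀ α : ℝ, 0 < α → α < α₀ →
      ∃ Ap Am : E3, IsInitialLimits c₀ α Ap Am ∧ Ap ≠ Am := by
  obtain ⟨n, b, hF⟩ := profile_spec c₀ 0
  have h := hF.component 0
  set m : ℝ → ℝ := fun s => profile c₀ 0 s 0 with hm
  obtain ⟨a, ha⟩ : ∃ a, Tendsto m atTop (𝓝 a) := by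
    refine cauchySeq_tendsto_of_complete (Metric.cauchySeq_iff'.2 fun ε hε => ?_)
    have hN : 0 < 8 * c₀ / ε + 1 := by positivity
    refine ⟨8 * c₀ / ε + 1, fun t ht => ?_⟩
    rw [Real.dist_eq]
    refine (h.abs_m_sub_le_of_profile hc.le le_rfl (by norm_num) hN ht).trans_lt ?_
    rw [div_lt_iff₀ hN, mul_add, mul_div_cancel₀ _ hε.ne']
    linarith
  have ha1 := h.abs_limit_lt_one hc (by simp [hF.b_zero]) ha
  -- Three errors of size δ arise: the convergence of m for α = 0, the comparison on [0, S], and the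
  -- tail beyond S. Then |A₀| < |a| + 3δ < 1.
  set δ := (1 - |a|) / 4 with hδ
  have hδ0 : 0 < δ := by rw [hδ]; linarith
  obtain ⟨S, hS1, hmS⟩ : ∃ S : ℝ, 8 * c₀ / δ + 1 ≤ S ∧ |m S| < |a| + δ :=
    ((eventually_ge_atTop _).and
      (ha.abs.eventually (eventually_lt_nhds (by linarith)))).exists
  have hS0 : 0 < S := lt_of_lt_of_le (by positivity) hS1
  have htail : 8 * c₀ / S ≤ δ := by
    rw [div_le_iff₀ hS0]
    have : 8 * c₀ / δ ≤ S := by linarith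
    rw [div_le_iff₀ hδ0] at this
    linarith
  -- `sq_sub_le` bounds the squared error at S by αK, so α ≤ δ²/K makes the error at most δ.
  set K := 8 * (c₀ * S ^ 2 + S) * S with hK
  have hK0 : 0 < K := by positivity
  refine ⟨min (1 / 2) (δ ^ 2 / K), by positivity, (min_le_left _ _).trans_lt (by norm_num),
    fun α hα hlt => ?_⟩
  have hα2 : α ≤ 1 / 2 := hlt.le.trans (min_le_left _ _)
  have hαK : α * K ≤ δ ^ 2 := (le_div_iff₀ hK0).1 (hlt.le.trans (min_le_right _ _))
  obtain ⟨A, hA⟩ := exists_tendsto_profile c₀ hα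
  refine exists_initialLimits_ne_of_abs_lt hA ?_
  obtain ⟨n', b', hF'⟩ := profile_spec c₀ α
  have h' := hF'.component 0
  have h1 : |profile c₀ α S 0 - m S| ≤ δ := by
    refine abs_le_of_sq_le_sq ?_ hδ0.le
    refine (h'.sq_sub_le h (by simp [hm, hF.m_zero, hF'.m_zero]) (by simp [hF.n_zero, hF'.n_zero])
      (by simp [hF.b_zero, hF'.b_zero]) hS0.le
      (fun s hs => abs_curvature_sub_add_abs_torsion_sub_le hc.le hα.le (by linarith) hs)).trans ?_
    calc _ = α * K := by rw [hK]; ring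
      _ ≤ δ ^ 2 := hαK
  have h2 : |A 0 - profile c₀ α S 0| ≤ δ := by
    refine le_trans (le_of_tendsto ((tendsto_profile_apply hA 0).sub_const _).abs ?_) htail
    filter_upwards [eventually_ge_atTop S] with t ht
    exact h'.abs_m_sub_le_of_profile hc.le hα.le hα2 hS0 ht
  have h3 : |A 0| ≤ |A 0 - profile c₀ α S 0| + |profile c₀ α S 0 - m S| + |m S| := by
    calc |A 0| = |(A 0 - profile c₀ α S 0) + (profile c₀ α S 0 - m S) + m S| := by
          congr 1; ring
      _ ≤ _ := abs_add_three _ _ _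
  linarith

theorem proposition1p5 :
    (∀ α : ℝ, 0 < α → α < 1 →
      ∃ cstar : ℝ, 0 < cstar ∧ ∀ c₀ : ℝ, 0 < c₀ → c₀ < cstar →
        ∃ Ap Am : E3, IsInitialLimits c₀ α Ap Am ∧ Ap ≠ Am) ∧
    (∀ c₀ : ℝ, 0 < c₀ →
      ∃ α₀ : ℝ, 0 < α₀ ∧ α₀ < 1 ∧ ∀ α : ℝ, 0 < α → α < α₀ →
        ∃ Ap Am : E3, IsInitialLimits c₀ α Ap Am ∧ Ap ≠ Am) ∧
    (∀ c₀ : ℝ, 0 < c₀ → (∀ k : ℕ, c₀ ≠ k * Real.sqrt Real.pi) →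
      ∃ α₁ : ℝ, 0 < α₁ ∧ α₁ < 1 ∧ ∀ α : ℝ, α₁ < α → α < 1 →
        ∃ Ap Am : E3, IsInitialLimits c₀ α Ap Am ∧ Ap ≠ Am) :=
  ⟨fun _ hα _ => initialLimits_ne_of_small_curvature hα,
    fun _ hc => initialLimits_ne_of_small_damping hc,
    fun _ hc hk => initialLimits_ne_of_damping_near_one hc hk⟩
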